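/- Let $d\ge 2$ and $n\ge 2$, and let $\{|0\rangle,\dots,|d-1\rangle\}$ be the standard basis of $\mathbb{C}^d$. Consider the (unnormalized) $n$-qudit states in $(\mathbb{C}^d)^{\otimes n}$ $$\mathcal{G}(d,n)=\sum_{j=0}^{d-1}|j\rangle^{\otimes n},\qquad \mathcal{L}(d,n)=\sum_{j_1+\cdots+j_n=d-1}|j_1\cdots j_n\rangle,$$ $$\mathcal{M}(d,n)=\sum_{i=0}^{n-1}|0\rangle^{\otimes(n-i-1)}|d-1\rangle|0\rangle^{\otimes i}+\sum_{i+k+l=n-2}\ \sum_{j=1}^{d-2}|0\rangle^{\otimes i}|j\rangle|0\rangle^{\otimes k}|d-j-1\rangle|0\rangle^{\otimes l},$$ $$\mathcal{N}(d,n)=|0\rangle^{\otimes(n-1)}|d-1\rangle+\sum_{i=0}^{n-2}\sum_{j=1}^{d-1}|0\rangle^{\otimes(n-i-2)}|j\rangle|0\rangle^{\otimes i}|d-j-1\rangle,$$ where all summation indices are non-negative integers. For $\psi\in U_1\otimes\cdots\otimes U_n$ and $\varphi\in V_1\otimes\cdots\otimes V_n$ (complex vector spaces) write $\psi\xrightarrow{\mathrm{SLOCC}}\varphi$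 if there are linear maps $A_i:U_i\to V_i$ with $(A_1\otimes\cdots\otimes A_n)\psi=\varphi$. Let $\psi^{\boxtimes m}\in\bigotimes_{i=1}^n U_i^{\otimes m}$ be the $m$-th Kronecker power of $\psi$, i.e. $m$ copies of $\psi$ regarded as an $n$-partite tensor whose $i$-th party holds the $i$-th factor of every copy. Define the rate of asymptotic SLOCC transformation $$\omega(\psi,\varphi)=\lim_{N\to\infty}\frac1N\inf\{m\in\mathbb{N}\mid \psi^{\boxtimes m}\xrightarrow{\mathrm{SLOCC}}\varphi^{\boxtimes N}\}\in[0,\infty]$$ whenever this limit exists (with $\inf\emptyset=\infty$). **Theorem.** The limits defining the following rates exist, and $$\omega(\mathcal{G}(d,n),\mathcal{L}(d,n))=1,\qquad \omega(\mathcal{G}(d,n),\mathcal{M}(d,n))=1,\qquad \omega(\mathcal{G}(d,n),\mathcal{N}(d,n))=1.$$ -/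

import Mathlib

open Filter Topology
open scoped TensorProduct ENNReal

noncomputable section

namespace SLOCCRate

/-- SLOCC convertibility of `n`-partite tensors: there are linear maps `A i : U i → V i` on the
single parties with `(⨂ i, A i) ψ = φ`. -/
def SLOCC {n : ℕ} {U V : Fin n → Type*}
    [∀ i, AddCommGroup (U i)] [∀ i, Module ℂ (U i)]
    [∀ i, AddCommGroup (V i)] [∀ i, Module ℂ (V i)]
    (ψ : ⨂[ℂ] i, U i) (φ : ⨂[ℂ] i, V i) : Prop :=
  ∃ A : ∀ i, U i →ₗ[ℂ] V i, PiTensorProduct.map A ψ = φ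

/-- The bilinear map `V^{⊗m} × V → V^{⊗(m+1)}`, `(v₁ ⊗ ⋯ ⊗ vₘ, v) ↦ v₁ ⊗ ⋯ ⊗ vₘ ⊗ v`. -/
def appendFactor (V : Type*) [AddCommGroup V] [Module ℂ V] (m : ℕ) :
    (⨂[ℂ]^m V) →ₗ[ℂ] V →ₗ[ℂ] (⨂[ℂ]^(m + 1) V) :=
  ((TensorProduct.mk ℂ (⨂[ℂ]^m V) (⨂[ℂ]^1 V)).compr₂
      (TensorPower.mulEquiv (R := ℂ) (M := V) (n := m) (m := 1)).toLinearMap).compl₂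
    (PiTensorProduct.subsingletonEquiv (R := ℂ) (s := fun _ : Fin 1 => V) 0).symm.toLinearMap

/-- The `m`-th Kronecker power `ψ^{⊠m}` (that is, `m` copies of `ψ` shared by the same `n` parties):
an `n`-partite tensor whose `i`-th party has the local space `(V i)^{⊗m}`. The map
`(x, ψ) ↦ x ⊠ ψ` is the bilinear map that appends, for every party `i`, the `i`-th factor of `ψ` to
the `i`-th factor of `x`. -/
def kronPow {n : ℕ} {V : Fin n → Type*} [∀ i, AddCommGroup (V i)] [∀ i, Module ℂ (V i)]
    (ψ : ⨂[ℂ] i, V i) : ∀ m : ℕ, ⨂[ℂ] i, (⨂[ℂ]^m (V i))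
  | 0 => PiTensorProduct.tprod ℂ fun _ => PiTensorProduct.tprod ℂ Fin.elim0
  | m + 1 => PiTensorProduct.map₂ (fun i => appendFactor (V i) m) (kronPow ψ m) ψ

/-- The least `m` such that `ψ^{⊠m}` is SLOCC convertible to `φ^{⊠N}` (`⊤` if there is none). -/
def sloccCost {n : ℕ} {U V : Fin n → Type*}
    [∀ i, AddCommGroup (U i)] [∀ i, Module ℂ (U i)]
    [∀ i, AddCommGroup (V i)] [∀ i, Module ℂ (V i)]
    (ψ : ⨂[ℂ] i, U i) (φ : ⨂[ℂ] i, V i) (N : ℕ) : ℕ∞ :=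
  ⨅ (m : ℕ) (_ : SLOCC (kronPow ψ m) (kronPow φ N)), (m : ℕ∞)

/-- `ω(ψ, φ) = r`: the limit defining the rate of asymptotic SLOCC transformation from `ψ` into `φ`,
`lim_{N → ∞} (1/N) · inf {m | ψ^{⊠m} → φ^{⊠N}}`, exists and equals `r`. -/
def HasSLOCCRate {n : ℕ} {U V : Fin n → Type*}
    [∀ i, AddCommGroup (U i)] [∀ i, Module ℂ (U i)]
    [∀ i, AddCommGroup (V i)] [∀ i, Module ℂ (V i)]
    (ψ : ⨂[ℂ] i, U i) (φ : ⨂[ℂ] i, V i) (r : ℝ≥0∞) : Prop :=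
  Tendsto (fun N : ℕ => (sloccCost ψ φ N : ℝ≥0∞) / (N : ℝ≥0∞)) atTop (𝓝 r)

/-- The computational basis vector `|k⟩` of `ℂ^d`, for `k < d`. -/
def ket (d k : ℕ) : Fin d → ℂ := fun j => if (j : ℕ) = k then 1 else 0

/-- The space `(ℂ^d)^{⊗n}` of `n`-qudit states (not normalized). -/
abbrev Qudits (d n : ℕ) : Type := ⨂[ℂ] _i : Fin n, (Fin d → ℂ)

/-- The product state `|k 0⟩ ⊗ ⋯ ⊗ |k (n-1)⟩`. -/
def prodKet (d : ℕ) {n : ℕ} (k : Fin n → ℕ) : Qudits d n :=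
  PiTensorProduct.tprod ℂ fun p => ket d (k p)

/-- The state `𝒢(d,n) = ∑_{j<d} |j ⋯ j⟩`. -/
def ghzState (d n : ℕ) : Qudits d n :=
  ∑ j ∈ Finset.range d, prodKet d fun _ => j

/-- The state `ℒ(d,n) = ∑_{j₁+⋯+jₙ=d-1} |j₁ ⋯ jₙ⟩`. -/
def lState (d n : ℕ) : Qudits d n :=
  ∑ j : Fin n → Fin d with (∑ p, (j p : ℕ)) = d - 1, prodKet d fun p => (j p : ℕ)

/-- The state `ℳ(d,n)`: the sum of all `|0 ⋯ 0 (d-1) 0 ⋯ 0⟩`, over the positions of `d-1`, and of all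
`|0 ⋯ 0 j 0 ⋯ 0 (d-j-1) 0 ⋯ 0⟩` with `1 ≤ j ≤ d-2`, over the pairs of positions `q < r`. -/
def mState (d n : ℕ) : Qudits d n :=
  (∑ q : Fin n, prodKet d fun p => if p = q then d - 1 else 0) +
    ∑ q : Fin n, ∑ r : Fin n with q < r, ∑ j ∈ Finset.Icc 1 (d - 2),
      prodKet d fun p => if p = q then j else if p = r then d - j - 1 else 0

/-- The state `𝒩(d,n)`: the sum of `|0 ⋯ 0⟩|d-1⟩` and of all `|0 ⋯ 0 j 0 ⋯ 0⟩|d-j-1⟩` with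
`1 ≤ j ≤ d-1`, over the positions `q` of `j` among the first `n-1` parties. -/
def nState (d n : ℕ) : Qudits d n :=
  (prodKet d fun p : Fin n => if (p : ℕ) + 1 = n then d - 1 else 0) +
    ∑ q ∈ Finset.univ.filter (fun q : Fin n => (q : ℕ) + 1 < n), ∑ j ∈ Finset.Icc 1 (d - 1),
      prodKet d fun p => if p = q then j else if (p : ℕ) + 1 = n then d - j - 1 else 0

end SLOCCRate

end

/-!
All three target states are *weight states*: for suitable weights `w p j` of the basis vector `|j⟩`
at the party `p`, the state is the sum of `|j₁ ⋯ jₙ⟩` over all index tuples with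
`j₁ + ⋯ + jₙ ≡ d - 1` modulo `d` whose total weight has the value `A`, and `A` is the least weight
of any tuple with this congruence (`lState_eq_weightState`, `mState_eq_weightState`,
`nState_eq_weightState`).

*Upper bound.* Giving each tuple the factor `ε ^ weight` and dropping the condition on the weight
yields a state that a Fourier transform over `ℤ/d` writes as a sum of `d` product vectors
(`sum_smul_tprod_fourier`), so that its `N`-th power is a sum of `d ^ N` product vectors. Since `A`
is the least weight, the `N`-th power of the weight state is the coefficient of `ε ^ (N * A)` in
this power. That coefficient is an average over `Q = O(N)` roots of unity `ε`, so the rank of the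
`N`-th power is at most `Q * d ^ N`. The GHZ power `𝒢^{⊠m}` converts into every tensor of rank at
most `d ^ m`, hence `m = N + O(log N)` copies suffice (`slocc_ghzState_weightState`).

*Lower bound.* Contracting all parties but two with `⟨0|` turns the target state into
`∑ |a⟩|d - 1 - a⟩`, whose `N`-th power is a matrix of rank `d ^ N`, whereas every contraction of
`𝒢^{⊠m}` to two parties has rank at most `d ^ m`. So `m ≥ N` (`le_of_slocc_ghzState_weightState`).
-/

noncomputable section

namespace SLOCCRate

/-! ### Kronecker powers -/

theorem appendFactor_tprod {V : Type*} [AddCommGroup V] [Module ℂ V] {m : ℕ}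
    (x : Fin m → V) (v : V) :
    appendFactor V m (PiTensorProduct.tprod ℂ x) v =
      PiTensorProduct.tprod ℂ (Fin.snoc x v : Fin (m + 1) → V) := by
  have h : (PiTensorProduct.subsingletonEquiv (R := ℂ) (s := fun _ : Fin 1 => V) 0).symm v =
      PiTensorProduct.tprod ℂ (fun _ : Fin 1 => v) := by
    rw [LinearEquiv.symm_apply_eq]
    simp
  simp only [appendFactor, LinearMap.compl₂_apply, LinearMap.compr₂_apply,
    LinearEquiv.coe_coe, TensorProduct.mk_apply, h]
  have := TensorPower.tprod_mul_tprod ℂ x (fun _ : Fin 1 => v)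
  rw [Fin.append_right_eq_snoc] at this
  exact this

/-- The Kronecker power of a sum of product vectors, expanded into product vectors indexed by the
`N`-tuples of terms. -/
theorem kronPow_sum_smul_tprod {n : ℕ} {V : Fin n → Type*} [∀ i, AddCommGroup (V i)]
    [∀ i, Module ℂ (V i)] {ι : Type*} [Fintype ι] (c : ι → ℂ) (v : ι → ∀ p, V p) (N : ℕ) :
    kronPow (∑ i, c i • PiTensorProduct.tprod ℂ (v i)) N =
      ∑ I : Fin N → ι, (∏ t, c (I t)) •
        PiTensorProduct.tprod ℂ fun p => PiTensorProduct.tprod ℂ fun t => v (I t) p := by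
  induction N with
  | zero =>
    simp only [kronPow, Finset.univ_unique, Finset.sum_singleton, Finset.univ_eq_empty,
      Finset.prod_empty, one_smul]
    congr 1; funext p; congr 1; funext t; exact t.elim0
  | succ N ih =>
    rw [kronPow, ih, ← (Fin.snocEquiv fun _ : Fin (N + 1) => ι).sum_comp, Fintype.sum_prod_type]
    simp only [map_sum, LinearMap.sum_apply, map_smul, LinearMap.smul_apply,
      PiTensorProduct.map₂_tprod_tprod, appendFactor_tprod, Finset.smul_sum, smul_smul]
    refine Finset.sum_congr rfl fun i _ => Finset.sum_congr rfl fun I _ => ?_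
    rw [Fin.prod_univ_castSucc]
    simp only [Fin.snocEquiv_apply, Fin.snoc_castSucc, Fin.snoc_last]
    congr 1
    · ring
    · congr 1; funext p; congr 1; funext t
      refine Fin.lastCases ?_ (fun t => ?_) t <;> simp

/-! ### Powers of the GHZ state -/

/-- The linear functional on `(ℂ^d)^{⊗ι}` that reads off the coefficient of `⨂ t, |a t⟩`. -/
def coeffFunctional {ι : Type*} [Fintype ι] {d : ℕ} (a : ι → Fin d) :
    (⨂[ℂ] _t : ι, (Fin d → ℂ)) →ₗ[ℂ] ℂ :=
  PiTensorProduct.lift ((MultilinearMap.mkPiAlgebra ℂ ι ℂ).compLinearMap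
    fun t => LinearMap.proj (a t))

theorem coeffFunctional_tprod {ι : Type*} [Fintype ι] {d : ℕ} (a : ι → Fin d)
    (x : ι → Fin d → ℂ) :
    coeffFunctional a (PiTensorProduct.tprod ℂ x) = ∏ t, x t (a t) := by
  simp [coeffFunctional]

theorem ket_apply {d : ℕ} (k : ℕ) (a : Fin d) : ket d k a = if (a : ℕ) = k then 1 else 0 := rfl

theorem coeffFunctional_tprod_ket {ι : Type*} [Fintype ι] {d : ℕ} (a b : ι → Fin d) :
    coeffFunctional a (PiTensorProduct.tprod ℂ fun t => ket d (b t)) = if a = b then 1 else 0 := by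
  simp only [coeffFunctional_tprod, ket_apply, Finset.prod_ite_zero, Finset.prod_const_one,
    Finset.mem_univ, true_implies, Fin.val_inj, funext_iff]

theorem kronPow_ghzState (d n m : ℕ) :
    kronPow (ghzState d n) m = ∑ k : Fin m → Fin d,
      PiTensorProduct.tprod ℂ fun _ => PiTensorProduct.tprod ℂ fun t => ket d (k t) := by
  have h : ghzState d n = ∑ j : Fin d, (1 : ℂ) • PiTensorProduct.tprod ℂ fun _ => ket d j := by
    simp only [ghzState, prodKet, one_smul]
    exact Finset.sum_range fun j => PiTensorProduct.tprod ℂ fun _ : Fin n => ket d j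
  rw [h, kronPow_sum_smul_tprod]
  simp

/-- The `m`-th power of the GHZ state converts into every tensor of rank at most `d^m`. -/
theorem slocc_kronPow_ghzState {d n m : ℕ} {V : Fin n → Type*} [∀ p, AddCommGroup (V p)]
    [∀ p, Module ℂ (V p)] (hn : n ≠ 0) {ι : Type*} [Fintype ι] (hι : Fintype.card ι ≤ d ^ m)
    (c : ι → ℂ) (u : ι → ∀ p, V p) :
    SLOCC (kronPow (ghzState d n) m) (∑ i, c i • PiTensorProduct.tprod ℂ (u i)) := by
  classical
  obtain ⟨e⟩ : Nonempty (ι ↪ (Fin m → Fin d)) :=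
    Function.Embedding.nonempty_of_card_le (by simpa using hι)
  let p₀ : Fin n := ⟨0, Nat.pos_of_ne_zero hn⟩
  -- The coefficient `c i` is absorbed by the single party `p₀`.
  let A : ∀ p, (⨂[ℂ]^m (Fin d → ℂ)) →ₗ[ℂ] V p := fun p =>
    ∑ i, (coeffFunctional (e i)).smulRight ((if p = p₀ then c i else 1) • u i p)
  have hA : ∀ p (k : Fin m → Fin d), A p (PiTensorProduct.tprod ℂ fun t => ket d (k t)) =
      ∑ i, if e i = k then (if p = p₀ then c i else 1) • u i p else 0 := by
    intro p k
    simp only [A, LinearMap.sum_apply, LinearMap.smulRight_apply, coeffFunctional_tprod_ket,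
      ite_smul, one_smul, zero_smul]
  refine ⟨A, ?_⟩
  rw [kronPow_ghzState, map_sum]
  simp only [PiTensorProduct.map_tprod, hA]
  have hz : ∀ k ∈ Finset.univ, k ∉ Finset.univ.image e → (PiTensorProduct.tprod ℂ fun p =>
      ∑ i, if e i = k then (if p = p₀ then c i else 1) • u i p else 0) = 0 := by
    intro k _ hk
    refine MultilinearMap.map_coord_zero _ p₀ (Finset.sum_eq_zero fun i _ => if_neg ?_)
    rintro rfl
    exact hk (Finset.mem_image_of_mem e (Finset.mem_univ i))
  rw [← Finset.sum_subset (Finset.subset_univ _) hz, Finset.sum_image fun _ _ _ _ h => e.injective h]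
  refine Finset.sum_congr rfl fun i _ => ?_
  simp only [e.injective.eq_iff, Finset.sum_ite_eq', Finset.mem_univ, if_true]
  rw [MultilinearMap.map_smul_univ]
  simp

/-! ### Weight states and the upper bound -/

theorem sum_pow_eq_ite {Q : ℕ} {ζ : ℂ} (hζ : IsPrimitiveRoot ζ Q) (x : ℕ) :
    ∑ s : Fin Q, (ζ ^ (s : ℕ)) ^ x = if Q ∣ x then (Q : ℂ) else 0 := by
  rw [← Finset.sum_range fun s => (ζ ^ s) ^ x]
  split_ifs with h
  · simp [pow_right_comm ζ _ x, (hζ.pow_eq_one_iff_dvd x).2 h]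
  · simp_rw [pow_right_comm ζ _ x]
    have h1 : ζ ^ x ≠ 1 := fun h' => h ((hζ.pow_eq_one_iff_dvd x).1 h')
    have := mul_geom_sum (ζ ^ x) Q
    rw [pow_right_comm, hζ.pow_eq_one, one_pow, sub_self] at this
    exact (mul_eq_zero.1 this).resolve_left (sub_ne_zero.2 h1)

/-- The state `∑ |j₁ ⋯ jₙ⟩` over all `j` with `j₁ + ⋯ + jₙ ≡ d - 1` modulo `d` whose weight
`w₁(j₁) + ⋯ + wₙ(jₙ)` is `A`. -/
def weightState (d n : ℕ) (w : Fin n → ℕ → ℕ) (A : ℕ) : Qudits d n :=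
  ∑ J : Fin n → Fin d with d ∣ (∑ p, (J p : ℕ)) + 1 ∧ ∑ p, w p (J p) = A,
    prodKet d fun p => (J p : ℕ)

theorem kronPow_weightState (d n : ℕ) (w : Fin n → ℕ → ℕ) (A N : ℕ) :
    kronPow (weightState d n w A) N = ∑ J : Fin N → Fin n → Fin d,
      (∏ t, if d ∣ (∑ p, (J t p : ℕ)) + 1 ∧ ∑ p, w p (J t p) = A then (1 : ℂ) else 0) •
        PiTensorProduct.tprod ℂ fun p => PiTensorProduct.tprod ℂ fun t => ket d (J t p) := by
  rw [← kronPow_sum_smul_tprod (fun J : Fin n → Fin d =>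
    if d ∣ (∑ p, (J p : ℕ)) + 1 ∧ ∑ p, w p (J p) = A then (1 : ℂ) else 0)
    (fun J p => ket d (J p))]
  simp only [weightState, prodKet, Finset.sum_filter, ite_smul, one_smul, zero_smul]

/-- The discrete Fourier transform over `ℤ/d` writes the `ε`-deformation of a weight state as a
combination of only `d` product vectors. -/
theorem sum_smul_tprod_fourier {d n : ℕ} (hd : d ≠ 0) (w : Fin n → ℕ → ℕ) {ω : ℂ}
    (hω : IsPrimitiveRoot ω d) (ε : ℂ) :
    ∑ k : Fin d, ((d : ℂ)⁻¹ * ω ^ (k : ℕ)) • (PiTensorProduct.tprod ℂ fun p : Fin n =>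
        ∑ j : Fin d, ((ω ^ (k : ℕ)) ^ (j : ℕ) * ε ^ w p j) • ket d j) =
      ∑ J : Fin n → Fin d,
        (if d ∣ (∑ p, (J p : ℕ)) + 1 then ε ^ ∑ p, w p (J p) else 0) •
          PiTensorProduct.tprod ℂ fun p => ket d (J p) := by
  simp only [MultilinearMap.map_sum, MultilinearMap.map_smul_univ, Finset.smul_sum, smul_smul]
  rw [Finset.sum_comm]
  refine Finset.sum_congr rfl fun J _ => ?_
  rw [← Finset.sum_smul]
  congr 1
  have h : ∀ k : Fin d, (d : ℂ)⁻¹ * ω ^ (k : ℕ) *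
      ∏ p, ((ω ^ (k : ℕ)) ^ (J p : ℕ) * ε ^ w p (J p)) =
      (d : ℂ)⁻¹ * ε ^ (∑ p, w p (J p)) * (ω ^ (k : ℕ)) ^ ((∑ p, (J p : ℕ)) + 1) := by
    intro k
    rw [Finset.prod_mul_distrib, Finset.prod_pow_eq_pow_sum, Finset.prod_pow_eq_pow_sum, pow_succ]
    ring
  simp only [h]
  rw [← Finset.mul_sum, sum_pow_eq_ite hω]
  have : (d : ℂ) ≠ 0 := by exact_mod_cast hd
  split_ifs
  · field_simp
  · simp

/-- The `N`-th power of a weight state of minimal weight is an average over the `Q`-th roots of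
unity `ε` of the `N`-th powers of its `ε`-deformations: since every single weight is at least
`A`, a total weight `N * A` forces all the weights to be `A`. -/
theorem slocc_ghzState_weightState {d n : ℕ} (hd : d ≠ 0) (hn : n ≠ 0) (w : Fin n → ℕ → ℕ) (A : ℕ)
    (hA : ∀ J : Fin n → Fin d, d ∣ (∑ p, (J p : ℕ)) + 1 → A ≤ ∑ p, w p (J p)) {N m : ℕ}
    (hm : d ^ N * (N * (∑ p, ∑ j : Fin d, w p j) + 1) ≤ d ^ m) :
    SLOCC (kronPow (ghzState d n) m) (kronPow (weightState d n w A) N) := by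
  -- `Q` exceeds every total weight, so characters of `ℤ/Q` separate the total weights.
  set Q := N * (∑ p, ∑ j : Fin d, w p j) + 1 with hQ
  have hω := Complex.isPrimitiveRoot_exp d hd
  have hζ := Complex.isPrimitiveRoot_exp Q (Nat.succ_ne_zero _)
  set ω := Complex.exp (2 * Real.pi * Complex.I / d)
  set ζ := Complex.exp (2 * Real.pi * Complex.I / Q)
  have hζ0 : ζ ≠ 0 := Complex.exp_ne_zero _
  have key : kronPow (weightState d n w A) N =
      ∑ i : Fin Q × (Fin N → Fin d),
        ((Q : ℂ)⁻¹ * ((ζ ^ (i.1 : ℕ)) ^ (N * A))⁻¹ *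
          ∏ t, ((d : ℂ)⁻¹ * ω ^ (i.2 t : ℕ))) •
        PiTensorProduct.tprod ℂ fun p : Fin n => PiTensorProduct.tprod ℂ fun t =>
          ∑ j : Fin d, ((ω ^ (i.2 t : ℕ)) ^ (j : ℕ) * (ζ ^ (i.1 : ℕ)) ^ w p j) • ket d j := by
    trans ∑ s : Fin Q, ((Q : ℂ)⁻¹ * ((ζ ^ (s : ℕ)) ^ (N * A))⁻¹) •
      kronPow (∑ J : Fin n → Fin d,
        (if d ∣ (∑ p, (J p : ℕ)) + 1 then (ζ ^ (s : ℕ)) ^ ∑ p, w p (J p) else 0) •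
          PiTensorProduct.tprod ℂ fun p => ket d (J p)) N
    swap
    · rw [Fintype.sum_prod_type]
      refine Finset.sum_congr rfl fun s _ => ?_
      rw [← sum_smul_tprod_fourier hd w hω, kronPow_sum_smul_tprod, Finset.smul_sum]
      exact Finset.sum_congr rfl fun I _ => smul_smul _ _ _
    simp only [kronPow_sum_smul_tprod, Finset.smul_sum, smul_smul]
    rw [Finset.sum_comm, kronPow_weightState]
    refine Finset.sum_congr rfl fun J _ => ?_
    rw [← Finset.sum_smul]
    congr 1
    simp only [Finset.prod_ite_zero, Finset.prod_const_one, Finset.mem_univ, true_implies]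
    by_cases hJ : ∀ t, d ∣ (∑ p, (J t p : ℕ)) + 1
    · have hle : N * A ≤ ∑ t, ∑ p, w p (J t p) := by
        simpa using Finset.sum_le_sum fun t (_ : t ∈ Finset.univ) => hA (J t) (hJ t)
      have hlt : ∑ t, ∑ p, w p (J t p) < Q := by
        rw [hQ, Nat.lt_succ_iff]
        simpa using Finset.sum_le_sum fun t (_ : t ∈ Finset.univ) =>
          Finset.sum_le_sum fun p (_ : p ∈ Finset.univ) =>
            Finset.single_le_sum (f := fun j : Fin d => w p j) (fun _ _ => Nat.zero_le _)
              (Finset.mem_univ (J t p))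
      -- The average over `ε` tests whether the excess `x` of the total weight over `N * A` is zero.
      obtain ⟨x, hx⟩ := Nat.exists_eq_add_of_le hle
      have hterm : ∀ s : Fin Q, (Q : ℂ)⁻¹ * ((ζ ^ (s : ℕ)) ^ (N * A))⁻¹ *
          (∏ t, (ζ ^ (s : ℕ)) ^ ∑ p, w p (J t p)) = (Q : ℂ)⁻¹ * (ζ ^ (s : ℕ)) ^ x := by
        intro s
        rw [Finset.prod_pow_eq_pow_sum, hx, pow_add]
        have : (ζ ^ (s : ℕ)) ^ (N * A) ≠ 0 := pow_ne_zero _ (pow_ne_zero _ hζ0)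
        field_simp
      simp only [hJ, implies_true, if_true, true_and, hterm]
      rw [← Finset.mul_sum, sum_pow_eq_ite hζ]
      have hQ0 : (Q : ℂ) ≠ 0 := by exact_mod_cast (show Q ≠ 0 from Nat.succ_ne_zero _)
      have hiff : (∀ t, ∑ p, w p (J t p) = A) ↔ Q ∣ x := by
        constructor
        · intro h
          have : x = 0 := by simp only [h] at hx; simpa using hx
          simp [this]
        · intro h
          have hx0 : x = 0 := Nat.eq_zero_of_dvd_of_lt h (by omega)
          have := (Finset.sum_eq_sum_iff_of_le (s := Finset.univ) (f := fun _ : Fin N => A)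
            (g := fun t => ∑ p, w p (J t p)) fun t _ => hA (J t) (hJ t)).1
            (by simp [hx, hx0])
          exact fun t => (this t (Finset.mem_univ t)).symm
      by_cases h : Q ∣ x
      · rw [if_pos (hiff.2 h), if_pos h, inv_mul_cancel₀ hQ0]
      · rw [if_neg (mt hiff.1 h), if_neg h, mul_zero]
    · rw [if_neg fun h => hJ fun t => (h t).1]
      simp [hJ]
  rw [key]
  refine slocc_kronPow_ghzState hn ?_ _ _
  simpa [mul_comm] using hm

/-! ### The lower bound -/

/-- The assignment to the `n` parties that gives `a` to `p₀`, `b` to `p₁` and `z` to all others. -/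
def twoPartyIndex {n : ℕ} {α : Type*} (p₀ p₁ : Fin n) (z a b : α) : Fin n → α :=
  fun p => if p = p₀ then a else if p = p₁ then b else z

theorem sum_twoPartyIndex {n : ℕ} {α : Type*} {p₀ p₁ : Fin n} (hp : p₀ ≠ p₁) (z a b : α)
    (f : Fin n → α → ℕ) (hf : ∀ p, f p z = 0) :
    ∑ p, f p (twoPartyIndex p₀ p₁ z a b p) = f p₀ a + f p₁ b := by
  rw [← Finset.sum_subset (Finset.subset_univ {p₀, p₁}), Finset.sum_pair hp]
  · simp [twoPartyIndex, hp.symm]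
  · intro p _ h
    simp only [Finset.mem_insert, Finset.mem_singleton, not_or] at h
    simp [twoPartyIndex, h.1, h.2, hf]

/-- The functional on `n`-partite tensors over `((ℂ^d)^{⊗N})` that reads off the coefficient of
`⨂ p, ⨂ t, |a p t⟩`. -/
def partyCoeff {d n N : ℕ} (a : Fin n → Fin N → Fin d) :
    (⨂[ℂ] _p : Fin n, ⨂[ℂ]^N (Fin d → ℂ)) →ₗ[ℂ] ℂ :=
  PiTensorProduct.dualDistrib (PiTensorProduct.tprod ℂ fun p => coeffFunctional (a p))

theorem partyCoeff_tprod {d n N : ℕ} (a : Fin n → Fin N → Fin d)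
    (x : Fin n → ⨂[ℂ]^N (Fin d → ℂ)) :
    partyCoeff a (PiTensorProduct.tprod ℂ x) = ∏ p, coeffFunctional (a p) (x p) := by
  simp [partyCoeff, PiTensorProduct.dualDistrib_apply]

theorem partyCoeff_kronPow_weightState {d n N : ℕ} (w : Fin n → ℕ → ℕ) (A : ℕ)
    (a : Fin n → Fin N → Fin d) :
    partyCoeff a (kronPow (weightState d n w A) N) =
      ∏ t, if d ∣ (∑ p, (a p t : ℕ)) + 1 ∧ ∑ p, w p (a p t) = A then (1 : ℂ) else 0 := by
  rw [kronPow_weightState, map_sum, Finset.sum_eq_single fun t p => a p t]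
  · simp [partyCoeff_tprod, coeffFunctional_tprod_ket]
  · intro J _ hJ
    obtain ⟨p, hp⟩ : ∃ p, a p ≠ fun t => J t p := by
      by_contra! h
      exact hJ (funext fun t => funext fun p => (congrFun (h p) t).symm)
    rw [map_smul, partyCoeff_tprod, Finset.prod_eq_zero (Finset.mem_univ p), smul_zero]
    rw [coeffFunctional_tprod_ket, if_neg hp]
  · simp

theorem add_one_eq_of_dvd {d x : ℕ} (h : d ∣ x + 1) (hx : x + 1 < 2 * d) : x + 1 = d := by
  obtain ⟨q, hq⟩ := h
  have h0 : q ≠ 0 := by rintro rfl; simp at hq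
  have h2 : q < 2 := by
    by_contra! h
    have := Nat.mul_le_mul_left d h
    omega
  obtain rfl : q = 1 := by omega
  omega

/-- Contracting all parties but two with `⟨0|` turns the `N`-th power of the weight state into a
permutation matrix of size `d^N`, and the `m`-th power of the GHZ state into a matrix of rank at
most `d^m`. -/
theorem le_of_slocc_ghzState_weightState {d n : ℕ} (hd : 2 ≤ d) (w : Fin n → ℕ → ℕ) (A : ℕ)
    (hw : ∀ p, w p 0 = 0) {p₀ p₁ : Fin n} (hp : p₀ ≠ p₁)
    (hA : ∀ a b, a + b + 1 = d → w p₀ a + w p₁ b = A) {N m : ℕ}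
    (h : SLOCC (kronPow (ghzState d n) m) (kronPow (weightState d n w A) N)) : N ≤ m := by
  obtain ⟨T, hT⟩ := h
  let z : Fin d := ⟨0, by omega⟩
  let e : (Fin m → Fin d) → ⨂[ℂ]^m (Fin d → ℂ) := fun k =>
    PiTensorProduct.tprod ℂ fun t => ket d (k t)
  -- The index `a` of the rows is reversed, `a ↦ d - 1 - a`, so that the permutation matrix is `1`.
  let x : (Fin N → Fin d) → (Fin N → Fin d) → Fin n → Fin N → Fin d := fun a b =>
    twoPartyIndex p₀ p₁ (fun _ => z) (fun t => (a t).rev) b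
  let L : Matrix (Fin N → Fin d) (Fin m → Fin d) ℂ := .of fun a k =>
    coeffFunctional (fun t => (a t).rev) (T p₀ (e k))
  let R : Matrix (Fin m → Fin d) (Fin N → Fin d) ℂ := .of fun k b =>
    ∏ p ∈ Finset.univ.erase p₀, coeffFunctional (x b b p) (T p (e k))
  have hLR : L * R = 1 := by
    ext a b
    trans partyCoeff (x a b) (kronPow (weightState d n w A) N)
    · rw [← hT, kronPow_ghzState, map_sum, map_sum, Matrix.mul_apply]
      refine Finset.sum_congr rfl fun k _ => ?_
      rw [PiTensorProduct.map_tprod, partyCoeff_tprod,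
        ← Finset.mul_prod_erase _ _ (Finset.mem_univ p₀)]
      simp only [L, R, Matrix.of_apply]
      refine congrArg₂ (· * ·) ?_ (Finset.prod_congr rfl fun p hp => ?_)
      · simp [x, e, twoPartyIndex]
      · simp [x, e, twoPartyIndex, Finset.ne_of_mem_erase hp]
    · rw [partyCoeff_kronPow_weightState, Matrix.one_apply]
      have hx : ∀ p t, x a b p t = twoPartyIndex p₀ p₁ z (a t).rev (b t) p := by
        intro p t
        simp only [x, twoPartyIndex]
        split_ifs <;> rfl
      have hc : ∀ t, (d ∣ (∑ p, (x a b p t : ℕ)) + 1 ∧ ∑ p, w p (x a b p t) = A) ↔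
          a t = b t := by
        intro t
        simp only [hx]
        rw [sum_twoPartyIndex hp z (a t).rev (b t) (fun _ j => (j : ℕ)) fun _ => rfl,
          sum_twoPartyIndex hp z (a t).rev (b t) (fun p j => w p j) hw]
        have ha := (a t).isLt
        have hb := (b t).isLt
        have hr := Fin.val_rev (a t)
        constructor
        · rintro ⟨hdvd, -⟩
          have := add_one_eq_of_dvd hdvd (by omega)
          exact Fin.ext (by omega)
        · intro hab
          rw [← hab]
          have hsum : ((a t).rev : ℕ) + a t + 1 = d := by omega
          exact ⟨⟨1, by omega⟩, hA _ _ hsum⟩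
      simp only [hc, Finset.prod_ite_zero, Finset.prod_const_one, Finset.mem_univ, true_implies,
        funext_iff]
  have h1 := (Matrix.rank_mul_le_left L R).trans L.rank_le_card_width
  rw [hLR, Matrix.rank_one] at h1
  simp only [Fintype.card_fun, Fintype.card_fin] at h1
  exact (Nat.pow_le_pow_iff_right (by omega)).1 h1

/-! ### Asymptotic rates -/

theorem tendsto_log_linear_div (C : ℕ) :
    Tendsto (fun N : ℕ => ((Nat.log 2 (N * C + 1) + 1 : ℕ) : ℝ) / N) atTop (𝓝 0) := by
  have hlog : Tendsto (fun N : ℕ => Real.log N / N) atTop (𝓝 0) :=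
    (Real.isLittleO_log_id_atTop.tendsto_div_nhds_zero).comp tendsto_natCast_atTop_atTop
  have hc : ∀ c : ℝ, Tendsto (fun N : ℕ => c / N) atTop (𝓝 0) := fun c =>
    tendsto_const_nhds.div_atTop tendsto_natCast_atTop_atTop
  have h := ((hlog.add (hc (Real.log (C + 1)))).div_const (Real.log 2)).add (hc 1)
  simp only [add_zero, zero_div] at h
  refine tendsto_of_tendsto_of_tendsto_of_le_of_le' tendsto_const_nhds h
    (Eventually.of_forall fun N => by positivity) ?_
  filter_upwards [eventually_ge_atTop 1] with N hN
  have hN' : (1 : ℝ) ≤ N := by exact_mod_cast hN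
  have h2 : 0 < Real.log 2 := Real.log_pos one_lt_two
  have hpow : ((2 : ℝ) ^ Nat.log 2 (N * C + 1)) ≤ N * (C + 1) := by
    have : (2 : ℕ) ^ Nat.log 2 (N * C + 1) ≤ N * C + 1 := Nat.pow_log_le_self 2 (by omega)
    have : ((2 : ℝ) ^ Nat.log 2 (N * C + 1)) ≤ N * C + 1 := by exact_mod_cast this
    linarith
  have hle : (Nat.log 2 (N * C + 1) : ℝ) * Real.log 2 ≤ Real.log N + Real.log (C + 1) := by
    rw [← Real.log_mul (by positivity) (by positivity), ← Real.log_pow]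
    exact Real.log_le_log (by positivity) hpow
  have := (le_div_iff₀ h2).2 hle
  rw [← add_div, div_div, mul_comm (N : ℝ), ← div_div, ← add_div]
  push_cast
  gcongr

/-- The rate is `1` if the cost of `φ^{⊠N}` is at least `N` and at most `N + o(N)`. -/
theorem hasSLOCCRate_one {n : ℕ} {U V : Fin n → Type*}
    [∀ i, AddCommGroup (U i)] [∀ i, Module ℂ (U i)]
    [∀ i, AddCommGroup (V i)] [∀ i, Module ℂ (V i)]
    {ψ : ⨂[ℂ] i, U i} {φ : ⨂[ℂ] i, V i} (g : ℕ → ℕ)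
    (hg : Tendsto (fun N => (g N : ℝ) / N) atTop (𝓝 0))
    (hlower : ∀ N m, SLOCC (kronPow ψ m) (kronPow φ N) → N ≤ m)
    (hupper : ∀ N, SLOCC (kronPow ψ (N + g N)) (kronPow φ N)) : HasSLOCCRate ψ φ 1 := by
  have h : Tendsto (fun N : ℕ => ENNReal.ofReal (1 + (g N : ℝ) / N)) atTop (𝓝 1) := by
    simpa [Function.comp_def] using (ENNReal.continuous_ofReal.tendsto _).comp (hg.const_add 1)
  refine tendsto_of_tendsto_of_tendsto_of_le_of_le' tendsto_const_nhds h ?_ ?_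
  · filter_upwards [eventually_ge_atTop 1] with N hN
    rw [ENNReal.le_div_iff_mul_le (.inl (by simpa using by omega)) (.inl (by simp)), one_mul]
    have : (N : ℕ∞) ≤ sloccCost ψ φ N := le_iInf₂ fun m hm => by exact_mod_cast hlower N m hm
    simpa using ENat.toENNReal_le.2 this
  · filter_upwards [eventually_ge_atTop 1] with N hN
    have hN' : (0 : ℝ) < N := by exact_mod_cast hN
    have : sloccCost ψ φ N ≤ (N + g N : ℕ) := iInf₂_le (N + g N) (hupper N)
    have h1 := ENat.toENNReal_le.2 this
    rw [ENat.toENNReal_coe] at h1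
    refine (ENNReal.div_le_div_right h1 _).trans_eq ?_
    rw [← ENNReal.ofReal_natCast, ← ENNReal.ofReal_natCast N, ← ENNReal.ofReal_div_of_pos hN']
    congr 1
    push_cast
    field_simp

/-- Hypothesis `hmin` says that `A` is the least weight of an index tuple summing to `d - 1` modulo
`d`; it gives the upper bound. Hypotheses `hw` and `hA` say that the part of the state supported on
the parties `p₀` and `p₁` is `∑ |a⟩|d - 1 - a⟩`; they give the lower bound. -/
theorem hasSLOCCRate_ghzState_weightState {d n : ℕ} (hd : 2 ≤ d) (w : Fin n → ℕ → ℕ) (A : ℕ)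
    (hmin : ∀ J : Fin n → Fin d, d ∣ (∑ p, (J p : ℕ)) + 1 → A ≤ ∑ p, w p (J p))
    (hw : ∀ p, w p 0 = 0) {p₀ p₁ : Fin n} (hp : p₀ ≠ p₁)
    (hA : ∀ a b, a + b + 1 = d → w p₀ a + w p₁ b = A) :
    HasSLOCCRate (ghzState d n) (weightState d n w A) 1 := by
  refine hasSLOCCRate_one _ (tendsto_log_linear_div (∑ p, ∑ j : Fin d, w p j))
    (fun N m h => le_of_slocc_ghzState_weightState hd w A hw hp hA h) fun N => ?_
  have hn : n ≠ 0 := by rintro rfl; exact p₀.elim0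
  refine slocc_ghzState_weightState (by omega) hn w A hmin ?_
  rw [pow_add]
  refine Nat.mul_le_mul_left _ ((Nat.lt_pow_succ_log_self one_lt_two _).le.trans ?_)
  exact Nat.pow_le_pow_left hd _

/-! ### The state `ℒ` -/

theorem lState_eq_weightState {d n : ℕ} (hd : 2 ≤ d) :
    lState d n = weightState d n (fun _ j => j) (d - 1) := by
  rw [lState, weightState]
  congr 1
  refine Finset.filter_congr fun J _ => ⟨fun h => ⟨⟨1, by omega⟩, h⟩, fun h => h.2⟩

/-! ### Natural number tuples with a small sum -/

theorem sum_eq_zero_or_exists_eq_one {n : ℕ} {f : Fin n → ℕ} (h : ∑ p, f p < 2) :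
    (∀ p, f p = 0) ∨ ∃ q, f q = 1 ∧ ∀ p, p ≠ q → f p = 0 := by
  by_cases h0 : ∀ p, f p = 0
  · exact .inl h0
  · push Not at h0
    obtain ⟨q, hq⟩ := h0
    rw [← Finset.add_sum_erase _ _ (Finset.mem_univ q)] at h
    have h1 : ∑ p ∈ Finset.univ.erase q, f p = 0 := by omega
    rw [Finset.sum_eq_zero_iff] at h1
    exact .inr ⟨q, by omega, fun p hp => h1 p (by simp [hp])⟩

theorem exists_two_ones_of_sum_eq_two {n : ℕ} {f : Fin n → ℕ} (h : ∑ p, f p = 2)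
    (h2 : ∀ p, f p ≠ 2) :
    ∃ q r, q < r ∧ f q = 1 ∧ f r = 1 ∧ ∀ p, p ≠ q ∧ p ≠ r → f p = 0 := by
  obtain ⟨q, hq⟩ : ∃ q, f q ≠ 0 := by
    by_contra! h0
    simp [h0] at h
  have hsum := h
  rw [← Finset.add_sum_erase _ _ (Finset.mem_univ q)] at hsum
  have hq1 : f q = 1 := by have := h2 q; omega
  obtain ⟨r, hr, hr0⟩ : ∃ r ∈ Finset.univ.erase q, f r ≠ 0 := by
    by_contra! h0
    rw [Finset.sum_eq_zero h0] at hsum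
    omega
  rw [← Finset.add_sum_erase _ _ hr] at hsum
  have h1 : ∑ p ∈ (Finset.univ.erase q).erase r, f p = 0 := by omega
  rw [Finset.sum_eq_zero_iff] at h1
  have hz : ∀ p, p ≠ q → p ≠ r → f p = 0 := fun p hpq hpr => h1 p (by simp [hpq, hpr])
  rcases lt_or_gt_of_ne (Finset.ne_of_mem_erase hr) with hlt | hlt
  · exact ⟨r, q, hlt, by omega, hq1, fun p hp => hz p hp.2 hp.1⟩
  · exact ⟨q, r, hlt, hq1, by omega, fun p hp => hz p hp.1 hp.2⟩

/-! ### The state `ℳ` -/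

/-- The weights that single out `ℳ(d,n)`: the total weight is `2` for a single `d - 1` or for two
indices strictly between `0` and `d - 1`. -/
def mWeight (d j : ℕ) : ℕ := if j = 0 then 0 else if j + 1 = d then 2 else 1

theorem mWeight_eq_zero_iff {d j : ℕ} : mWeight d j = 0 ↔ j = 0 := by
  unfold mWeight; split_ifs <;> simp_all

theorem mWeight_eq_one_iff {d j : ℕ} : mWeight d j = 1 ↔ j ≠ 0 ∧ j + 1 ≠ d := by
  unfold mWeight; split_ifs <;> simp_all

theorem mWeight_eq_two_iff {d j : ℕ} : mWeight d j = 2 ↔ j ≠ 0 ∧ j + 1 = d := by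
  unfold mWeight; split_ifs <;> simp_all

theorem two_le_sum_mWeight {d n : ℕ} (hd : 2 ≤ d) (J : Fin n → Fin d)
    (h : d ∣ (∑ p, (J p : ℕ)) + 1) : 2 ≤ ∑ p, mWeight d (J p) := by
  by_contra! hlt
  rcases sum_eq_zero_or_exists_eq_one hlt with h0 | ⟨q, hq, h0⟩
  · simp only [mWeight_eq_zero_iff] at h0
    simp only [h0, Finset.sum_const_zero, zero_add, Nat.dvd_one] at h
    omega
  · simp only [mWeight_eq_zero_iff, mWeight_eq_one_iff] at h0 hq
    rw [Fintype.sum_eq_single q h0] at h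
    have := (J q).isLt
    exact hq.2 (add_one_eq_of_dvd h (by omega))

theorem mState_eq_weightState {d n : ℕ} (hd : 2 ≤ d) :
    mState d n = weightState d n (fun _ => mWeight d) 2 := by
  have : NeZero d := ⟨by omega⟩
  have hval : ∀ {j}, j < d → (Fin.ofNat d j : ℕ) = j := fun h => Nat.mod_eq_of_lt h
  rw [weightState, ← Finset.sum_filter_add_sum_filter_not _ (fun J => ∃ q, mWeight d (J q) = 2),
    mState]
  congr 1
  -- A tuple of weight `2` has either one entry of weight `2` or two entries of weight `1`.
  · refine Finset.sum_bij (fun q _ => Pi.single q (Fin.ofNat d (d - 1))) ?_ ?_ ?_ ?_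
    · intro q _
      have hs : ∀ f : ℕ → ℕ, f 0 = 0 →
          ∑ p, f ((Pi.single q (Fin.ofNat d (d - 1)) : Fin n → Fin d) p : ℕ) = f (d - 1) := by
        intro f hf
        rw [Fintype.sum_eq_single q]
        · rw [Pi.single_eq_same, hval (by omega)]
        · intro p hp
          rw [Pi.single_eq_of_ne hp]
          exact hf
      have h2 : mWeight d (d - 1) = 2 := mWeight_eq_two_iff.2 (by omega)
      simp only [Finset.mem_filter, Finset.mem_univ, true_and]
      refine ⟨⟨?_, ?_⟩, q, ?_⟩
      · rw [hs (fun j => j) rfl, Nat.sub_add_cancel (by omega)]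
      · rw [hs (mWeight d) (mWeight_eq_zero_iff.2 rfl), h2]
      · rw [Pi.single_eq_same, hval (by omega), h2]
    · intro q _ q' _ h
      by_contra hne
      have h1 := congrArg Fin.val (congrFun h q)
      rw [Pi.single_eq_same, Pi.single_eq_of_ne hne, hval (by omega), Fin.val_zero] at h1
      omega
    · intro J hJ
      simp only [Finset.mem_filter, Finset.mem_univ, true_and] at hJ
      obtain ⟨⟨-, hsum⟩, q, hq⟩ := hJ
      rw [← Finset.add_sum_erase _ _ (Finset.mem_univ q), hq, Nat.add_eq_left,
        Finset.sum_eq_zero_iff] at hsum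
      refine ⟨q, Finset.mem_univ q, funext fun p => Fin.ext ?_⟩
      rw [mWeight_eq_two_iff] at hq
      rcases eq_or_ne p q with rfl | hp
      · rw [Pi.single_eq_same, hval (by omega)]
        omega
      · rw [Pi.single_eq_of_ne hp]
        exact (mWeight_eq_zero_iff.1 (hsum p (by simp [hp]))).symm
    · intro q _
      congr 1
      funext p
      rcases eq_or_ne p q with rfl | hp
      · rw [Pi.single_eq_same, hval (by omega), if_pos rfl]
      · rw [Pi.single_eq_of_ne hp, if_neg hp]
        rfl
  · simp only [Finset.sum_sigma']
    refine Finset.sum_bij (fun x _ => twoPartyIndex x.1 x.2.1 0 (Fin.ofNat d x.2.2)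
      (Fin.ofNat d (d - x.2.2 - 1))) ?_ ?_ ?_ ?_
    · rintro ⟨q, r, j⟩ h
      simp only [Finset.mem_sigma, Finset.mem_filter, Finset.mem_univ, true_and,
        Finset.mem_Icc] at h
      obtain ⟨hqr, hj⟩ := h
      have h1 : mWeight d j = 1 := mWeight_eq_one_iff.2 (by omega)
      have h2 : mWeight d (d - j - 1) = 1 := mWeight_eq_one_iff.2 (by omega)
      simp only [Finset.mem_filter, Finset.mem_univ, true_and, not_exists]
      refine ⟨⟨?_, ?_⟩, fun p => ?_⟩
      · rw [sum_twoPartyIndex hqr.ne _ _ _ (fun _ (j : Fin d) => (j : ℕ)) fun _ => rfl,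
          hval (by omega), hval (by omega)]
        exact ⟨1, by omega⟩
      · rw [sum_twoPartyIndex hqr.ne _ _ _ (fun _ (j : Fin d) => mWeight d j)
          fun _ => mWeight_eq_zero_iff.2 rfl, hval (by omega), hval (by omega), h1, h2]
      · unfold twoPartyIndex
        split_ifs
        · rw [hval (by omega), h1]; decide
        · rw [hval (by omega), h2]; decide
        · simp [mWeight]
    · rintro ⟨q, r, j⟩ h ⟨q', r', j'⟩ h' heq
      simp only [Finset.mem_sigma, Finset.mem_filter, Finset.mem_univ, true_and,
        Finset.mem_Icc] at h h'
      obtain ⟨hqr, hj⟩ := h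
      obtain ⟨hqr', hj'⟩ := h'
      have hv : ∀ p, (if p = q then j else if p = r then d - j - 1 else 0) =
          if p = q' then j' else if p = r' then d - j' - 1 else 0 := by
        intro p
        have := congrArg Fin.val (congrFun heq p)
        simp only [twoPartyIndex, apply_ite Fin.val, Fin.val_zero] at this
        rwa [hval (by omega), hval (by omega), hval (by omega), hval (by omega)] at this
      have e1 := hv q
      have e2 := hv r
      have e3 := hv q'
      have e4 := hv r'
      simp only [if_true, hqr.ne', hqr'.ne', if_false] at e1 e2 e3 e4
      have hq : q = q' := by
        by_contra hne
        rw [if_neg hne] at e1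
        have h1 : q = r' := by by_contra h; rw [if_neg h] at e1; omega
        rw [if_neg (Ne.symm hne)] at e3
        have h2 : q' = r := by by_contra h; rw [if_neg h] at e3; omega
        subst h1 h2
        exact lt_asymm hqr hqr'
      subst hq
      have hr : r = r' := by
        by_contra hne
        rw [if_neg hqr.ne', if_neg hne] at e2
        omega
      subst hr
      simp only [if_true] at e1
      rw [e1]
    · intro J hJ
      simp only [Finset.mem_filter, Finset.mem_univ, true_and, not_exists] at hJ
      obtain ⟨⟨hdvd, hsum⟩, hne⟩ := hJ
      obtain ⟨q, r, hqr, hq, hr, h0⟩ := exists_two_ones_of_sum_eq_two hsum hne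
      simp only [mWeight_eq_zero_iff, mWeight_eq_one_iff] at hq hr h0
      rw [Fintype.sum_eq_add q r hqr.ne h0] at hdvd
      have hJq := (J q).isLt
      have hJr := (J r).isLt
      -- Two entries add up to at most `2 * d - 2`, so the congruence with `d - 1` is an equality.
      have hd1 := add_one_eq_of_dvd hdvd (by omega)
      refine ⟨⟨q, r, J q⟩, ?_, funext fun p => Fin.ext ?_⟩
      · simp only [Finset.mem_sigma, Finset.mem_filter, Finset.mem_univ, true_and,
          Finset.mem_Icc]
        exact ⟨hqr, by omega⟩
      · unfold twoPartyIndex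
        dsimp only
        split_ifs with h1 h2
        · rw [hval (by omega), h1]
        · rw [hval (by omega), h2]; omega
        · exact (h0 p ⟨h1, h2⟩).symm
    · rintro ⟨q, r, j⟩ h
      simp only [Finset.mem_sigma, Finset.mem_filter, Finset.mem_univ, true_and,
        Finset.mem_Icc] at h
      obtain ⟨hqr, hj⟩ := h
      congr 1
      funext p
      simp only [twoPartyIndex, apply_ite Fin.val, Fin.val_zero]
      rw [hval (by omega), hval (by omega)]

/-! ### The state `𝒩` -/

/-- The weights that single out `𝒩(d,n)`: the total weight is `1` if either the last index is
`d - 1` and all others vanish, or the last index is not `d - 1` and exactly one other index does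
not vanish. -/
def nWeight (d n : ℕ) (p : Fin n) (j : ℕ) : ℕ :=
  if (p : ℕ) + 1 = n then if j + 1 = d then 1 else 0 else if j = 0 then 0 else 1

theorem nWeight_zero {d n : ℕ} (hd : 2 ≤ d) (p : Fin n) : nWeight d n p 0 = 0 := by
  unfold nWeight; split_ifs <;> omega

theorem nWeight_last {d n : ℕ} {l : Fin n} (hl : (l : ℕ) + 1 = n) (j : ℕ) :
    nWeight d n l j = if j + 1 = d then 1 else 0 := if_pos hl

theorem add_one_eq_iff_eq_of_add_one_eq {n : ℕ} {l : Fin n} (hl : (l : ℕ) + 1 = n) (p : Fin n) :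
    (p : ℕ) + 1 = n ↔ p = l := by
  rw [Fin.ext_iff]; omega

theorem nWeight_of_ne {d n : ℕ} {l p : Fin n} (hl : (l : ℕ) + 1 = n) (hp : p ≠ l) (j : ℕ) :
    nWeight d n p j = if j = 0 then 0 else 1 :=
  if_neg (mt (add_one_eq_iff_eq_of_add_one_eq hl p).1 hp)

theorem one_le_sum_nWeight {d n : ℕ} (hn : 2 ≤ n) (J : Fin n → Fin d)
    (h : d ∣ (∑ p, (J p : ℕ)) + 1) : 1 ≤ ∑ p, nWeight d n p (J p) := by
  obtain ⟨l, hl⟩ : ∃ l : Fin n, (l : ℕ) + 1 = n := ⟨⟨n - 1, by omega⟩, by simp; omega⟩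
  by_contra! hlt
  rw [Nat.lt_one_iff, Finset.sum_eq_zero_iff] at hlt
  have hJ : ∀ p, p ≠ l → (J p : ℕ) = 0 := by
    intro p hp
    have := hlt p (Finset.mem_univ p)
    rw [nWeight_of_ne hl hp] at this
    simpa using this
  have hJl := hlt l (Finset.mem_univ l)
  rw [nWeight_last hl] at hJl
  rw [Fintype.sum_eq_single l hJ] at h
  have := (J l).isLt
  rw [if_pos (add_one_eq_of_dvd h (by omega))] at hJl
  exact one_ne_zero hJl

theorem nState_eq_weightState {d n : ℕ} (hd : 2 ≤ d) (hn : 2 ≤ n) :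
    nState d n = weightState d n (nWeight d n) 1 := by
  have : NeZero d := ⟨by omega⟩
  have hval : ∀ {j}, j < d → (Fin.ofNat d j : ℕ) = j := fun h => Nat.mod_eq_of_lt h
  obtain ⟨l, hl⟩ : ∃ l : Fin n, (l : ℕ) + 1 = n := ⟨⟨n - 1, by omega⟩, by simp; omega⟩
  have hl' := add_one_eq_iff_eq_of_add_one_eq hl
  have hlt : ∀ q : Fin n, (q : ℕ) + 1 < n ↔ q ≠ l := by
    intro q
    rw [Ne, ← hl']
    omega
  rw [weightState, ← Finset.sum_filter_add_sum_filter_not _ (fun J => (J l : ℕ) + 1 = d), nState]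
  simp only [hl', hlt]
  congr 1
  -- The only tuple of weight `1` with last entry `d - 1` is `(0, …, 0, d - 1)`.
  · symm
    rw [Finset.sum_eq_single (Pi.single l (Fin.ofNat d (d - 1)))]
    · congr 1
      funext p
      rcases eq_or_ne p l with rfl | hp
      · rw [Pi.single_eq_same, hval (by omega), if_pos rfl]
      · rw [Pi.single_eq_of_ne hp, if_neg hp]
        rfl
    · intro J hJ hne
      simp only [Finset.mem_filter, Finset.mem_univ, true_and] at hJ
      obtain ⟨⟨-, hsum⟩, hJl⟩ := hJ
      rw [← Finset.add_sum_erase _ _ (Finset.mem_univ l), nWeight_last hl, if_pos hJl,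
        Nat.add_eq_left, Finset.sum_eq_zero_iff] at hsum
      refine absurd (funext fun p => Fin.ext ?_) hne
      rcases eq_or_ne p l with rfl | hp
      · rw [Pi.single_eq_same, hval (by omega)]
        omega
      · have := hsum p (by simp [hp])
        rw [nWeight_of_ne hl hp] at this
        rw [Pi.single_eq_of_ne hp]
        simpa using this
    · intro h
      refine absurd ?_ h
      simp only [Finset.mem_filter, Finset.mem_univ, true_and]
      refine ⟨⟨?_, ?_⟩, ?_⟩
      · rw [Fintype.sum_eq_single l fun p hp => by rw [Pi.single_eq_of_ne hp]; rfl,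
          Pi.single_eq_same, hval (by omega), Nat.sub_add_cancel (by omega)]
      · rw [Fintype.sum_eq_single l fun p hp => by
            rw [Pi.single_eq_of_ne hp]; exact nWeight_zero hd p,
          Pi.single_eq_same, hval (by omega), nWeight_last hl, if_pos (by omega)]
      · rw [Pi.single_eq_same, hval (by omega)]
        omega
  · simp only [Finset.sum_sigma']
    refine Finset.sum_bij (fun x _ => twoPartyIndex x.1 l 0 (Fin.ofNat d x.2)
      (Fin.ofNat d (d - x.2 - 1))) ?_ ?_ ?_ ?_
    · rintro ⟨q, j⟩ h
      simp only [Finset.mem_sigma, Finset.mem_filter, Finset.mem_univ, true_and,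
        Finset.mem_Icc] at h
      obtain ⟨hql, hj⟩ := h
      simp only [Finset.mem_filter, Finset.mem_univ, true_and]
      refine ⟨⟨?_, ?_⟩, ?_⟩
      · rw [sum_twoPartyIndex hql _ _ _ (fun _ (j : Fin d) => (j : ℕ)) fun _ => rfl,
          hval (by omega), hval (by omega)]
        exact ⟨1, by omega⟩
      · rw [sum_twoPartyIndex hql _ _ _ (fun p (j : Fin d) => nWeight d n p j) (nWeight_zero hd),
          hval (by omega), hval (by omega), nWeight_of_ne hl hql, nWeight_last hl,
          if_neg (by omega), if_neg (by omega)]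
      · simp only [twoPartyIndex, hql.symm, if_false, if_true]
        rw [hval (by omega)]
        omega
    · rintro ⟨q, j⟩ h ⟨q', j'⟩ h' heq
      simp only [Finset.mem_sigma, Finset.mem_filter, Finset.mem_univ, true_and,
        Finset.mem_Icc] at h h'
      obtain ⟨hql, hj⟩ := h
      obtain ⟨hql', hj'⟩ := h'
      have hv := congrArg Fin.val (congrFun heq q)
      simp only [twoPartyIndex, apply_ite Fin.val, Fin.val_zero, if_true, hql, if_false] at hv
      rw [hval (by omega), hval (by omega)] at hv
      split_ifs at hv with hq
      · subst hq hv
        rfl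
      · omega
    · intro J hJ
      simp only [Finset.mem_filter, Finset.mem_univ, true_and] at hJ
      obtain ⟨⟨hdvd, hsum⟩, hJl⟩ := hJ
      rcases sum_eq_zero_or_exists_eq_one (hsum.trans_lt one_lt_two) with h0 | ⟨q, hq, h0⟩
      · simp [h0] at hsum
      · have hql : q ≠ l := by
          rintro rfl
          rw [nWeight_last hl, if_neg hJl] at hq
          exact zero_ne_one hq
        rw [nWeight_of_ne hl hql] at hq
        have hq0 : (J q : ℕ) ≠ 0 := fun h => by simp [h] at hq
        have hz : ∀ p, p ≠ q ∧ p ≠ l → (J p : ℕ) = 0 := by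
          intro p hp
          have := h0 p hp.1
          rw [nWeight_of_ne hl hp.2] at this
          simpa using this
        rw [Fintype.sum_eq_add q l hql hz] at hdvd
        have hJq := (J q).isLt
        have hJl' := (J l).isLt
        -- Two entries add up to at most `2 * d - 2`, so the congruence with `d - 1` is an equality.
        have hd1 := add_one_eq_of_dvd hdvd (by omega)
        refine ⟨⟨q, J q⟩, ?_, funext fun p => Fin.ext ?_⟩
        · simp only [Finset.mem_sigma, Finset.mem_filter, Finset.mem_univ, true_and,
            Finset.mem_Icc]
          exact ⟨hql, by omega⟩
        · unfold twoPartyIndex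
          dsimp only
          split_ifs with h1 h2
          · rw [hval (by omega), h1]
          · rw [hval (by omega), h2]; omega
          · exact (hz p ⟨h1, h2⟩).symm
    · rintro ⟨q, j⟩ h
      simp only [Finset.mem_sigma, Finset.mem_filter, Finset.mem_univ, true_and,
        Finset.mem_Icc] at h
      obtain ⟨hql, hj⟩ := h
      congr 1
      funext p
      simp only [twoPartyIndex, apply_ite Fin.val, Fin.val_zero]
      rw [hval (by omega), hval (by omega)]

end SLOCCRate

end

/-! ### The three rates -/

theorem mainTheorem8 (d n : ℕ) (hd : 2 ≤ d) (hn : 2 ≤ n) :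
    SLOCCRate.HasSLOCCRate (SLOCCRate.ghzState d n) (SLOCCRate.lState d n) 1 ∧
    SLOCCRate.HasSLOCCRate (SLOCCRate.ghzState d n) (SLOCCRate.mState d n) 1 ∧
    SLOCCRate.HasSLOCCRate (SLOCCRate.ghzState d n) (SLOCCRate.nState d n) 1 := by
  obtain ⟨l, hl⟩ : ∃ l : Fin n, (l : ℕ) + 1 = n := ⟨⟨n - 1, by omega⟩, by simp; omega⟩
  obtain ⟨q, hq⟩ : ∃ q : Fin n, q ≠ l := ⟨⟨0, by omega⟩, fun h => by simp [← h] at hl; omega⟩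
  rw [SLOCCRate.lState_eq_weightState hd, SLOCCRate.mState_eq_weightState hd,
    SLOCCRate.nState_eq_weightState hd hn]
  refine ⟨?_, ?_, ?_⟩
  · refine SLOCCRate.hasSLOCCRate_ghzState_weightState hd _ _ (fun J h => ?_) (fun _ => rfl) hq
      fun a b h => ?_
    · have := Nat.le_of_dvd (Nat.succ_pos _) h
      omega
    · omega
  · refine SLOCCRate.hasSLOCCRate_ghzState_weightState hd _ _
      (SLOCCRate.two_le_sum_mWeight hd) (fun _ => rfl) hq fun a b h => ?_
    unfold SLOCCRate.mWeight
    split_ifs <;> omega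
  · refine SLOCCRate.hasSLOCCRate_ghzState_weightState hd _ _
      (SLOCCRate.one_le_sum_nWeight hn) (SLOCCRate.nWeight_zero hd) hq fun a b h => ?_
    rw [SLOCCRate.nWeight_last hl, SLOCCRate.nWeight_of_ne hl hq]
    split_ifs <;> omega
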